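/- **Setting.** There are $m$ items and two (possibly overlapping) groups $G_1,G_2\subseteq[m]$. For $\sigma=(\sigma_1,\sigma_2)\in\{0,1\}^2$ let $I_\sigma$ be the set of items $i$ such that, for $\ell=1,2$, $i\in G_\ell$ if and only if $\sigma_\ell=1$. The latent utilities $w_1,\dots,w_m$ are independent draws from a probability distribution $\mathcal D$ with cumulative distribution function $F$ and quantile function $F^{-1}$. The observed utility of an item $i\in I_\sigma$ is $\widehat w_i=b_\sigma(w_i)$, where the bias functions $b_\sigma:\mathbb R_{\ge0}\to\mathbb R_{\ge0}$, $\sigma\in\{0,1\}^2$, are strictly increasing. Given $1\le n\le m$ and integers $L_1,L_2\ge0$ (non-intersectional lower bounds) such that some set of $n$ items contains at least $L_\ell$ items of $G_\ell$ for $\ell=1,2$, let $\widetilde x$ be such a set of $n$ items maximizing the total observed utility $\langle \widetilde x,\widehat w\rangle$, and let $x^\star$ be a set of $n$ items maximizing the total latent utility $\langle x^\star,w\rangle$ (sets are identified with their indicator vectors; both are almost surely unique under the assumptions below). The utility ratio is $$\mathscr R_{\mathcal D}(L,b)=\mathbb E_w\left[\frac{\langle\widetilde x,w\rangle}{\langle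 x^\star,w\rangle}\right].$$ **Assumptions on $\mathcal D$ and $b$**, for constants $c,d>0$. The support of $\mathcal D$ is an interval contained in $[0,1/c]$; $\mathcal D$ has a probability density that, on the support, is differentiable and takes values in $[c,1/c]$. For every $\sigma$, on the support of $\mathcal D$ the function $b_\sigma$ is differentiable, is at most $1/c$, and has derivative in $[d,1/c]$. **Theorem.** Let $c,\eta,\rho>0$. There is a threshold function $m_0$, depending only on $c,\eta,\rho$ and with $m_0(t)$ nonincreasing in $t>0$, such that the following holds. Let $d>0$, let $\mathcal D$ and $(b_\sigma)_\sigma$ satisfy the above assumptions, and let $m,n,G_1,G_2$ satisfy $\eta<\frac nm<1-\eta$ and $|I_\sigma|\ge\rho m$ for all $\sigma\in\{0,1\}^2$. Put $$B=(b_{00}-b_{10}-b_{01}+b_{11})\left(F^{-1}\left(1-\tfrac nm\right)\right),\qquad \phi_b=\left(c^4\rho\,\min\{\eta,1-\eta\}\,B\right)^2 .$$ If $m\ge m_0(|B|)$, then for all integers $L_1,L_2\ge0$ for which the lower bounds can be satisfied, $$\mathscr R_{\mathcal D}(L,b)\le 1-\phi_b .$$ -/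

import Mathlib

open MeasureTheory ProbabilityTheory Set

noncomputable section

namespace Selection

/-- The intersection `σ ∈ {0,1}²` an item belongs to: its `ℓ`-th bit is `1` (`true`) iff the item
is a member of the protected group `G_ℓ`. -/
def intersectionOf {m : ℕ} (G₁ G₂ : Finset (Fin m)) (i : Fin m) : Bool × Bool :=
  (decide (i ∈ G₁), decide (i ∈ G₂))

/-- The set `I_σ` of the items in the intersection `σ`. -/
def intersectionSet {m : ℕ} (G₁ G₂ : Finset (Fin m)) (σ : Bool × Bool) : Finset (Fin m) :=
  Finset.univ.filter fun i => intersectionOf G₁ G₂ i = σ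

/-- The total utility `⟨x, w⟩` of a selection `S` (with indicator vector `x`). -/
def utility {m : ℕ} (S : Finset (Fin m)) (w : Fin m → ℝ) : ℝ :=
  ∑ i ∈ S, w i

/-- The observed utilities: `ŵ_i = b_σ(w_i)` for every item `i ∈ I_σ`. -/
def observed {m : ℕ} (b : Bool × Bool → ℝ → ℝ) (G₁ G₂ : Finset (Fin m)) (w : Fin m → ℝ) :
    Fin m → ℝ :=
  fun i => b (intersectionOf G₁ G₂ i) (w i)

/-- `S` is a selection of `n` items with the highest latent utility `w`. -/
def IsLatentOptimal {m : ℕ} (n : ℕ) (w : Fin m → ℝ) (S : Finset (Fin m)) : Prop :=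
  S.card = n ∧ ∀ T : Finset (Fin m), T.card = n → utility T w ≤ utility S w

/-- `S` selects `n` items and satisfies the non-intersectional lower bounds: at least `L_ℓ` of the
selected items are in `G_ℓ`. -/
def IsFeasible {m : ℕ} (n L₁ L₂ : ℕ) (G₁ G₂ : Finset (Fin m)) (S : Finset (Fin m)) : Prop :=
  S.card = n ∧ L₁ ≤ (S ∩ G₁).card ∧ L₂ ≤ (S ∩ G₂).card

/-- `S` maximizes the observed utility `u` among the feasible selections. -/
def IsConstrainedOptimal {m : ℕ} (n L₁ L₂ : ℕ) (G₁ G₂ : Finset (Fin m)) (u : Fin m → ℝ)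
    (S : Finset (Fin m)) : Prop :=
  IsFeasible n L₁ L₂ G₁ G₂ S ∧
    ∀ T : Finset (Fin m), IsFeasible n L₁ L₂ G₁ G₂ T → utility T u ≤ utility S u

/-- The law of the latent utilities of `m` items: independent draws from `D`. -/
def latentLaw (m : ℕ) (D : Measure ℝ) : Measure (Fin m → ℝ) :=
  Measure.pi fun _ => D

/-- The quantile function `F⁻¹` of `D`. -/
def quantile (D : Measure ℝ) (p : ℝ) : ℝ :=
  sInf {x : ℝ | p ≤ cdf D x}

/-- The assumption on the latent distribution: a probability density `f`, differentiable on the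
support and with values in `[c, 1/c]` there; the support is an interval inside `[0, 1/c]`. -/
structure IsLatentDistribution (c : ℝ) (D : Measure ℝ) : Prop where
  isProbabilityMeasure : IsProbabilityMeasure D
  ordConnected_support : D.support.OrdConnected
  support_subset : D.support ⊆ Icc 0 (1 / c)
  exists_density : ∃ f : ℝ → ℝ, Measurable f ∧ (∀ x, 0 ≤ f x) ∧
    D = volume.withDensity (fun x => ENNReal.ofReal (f x)) ∧
    DifferentiableOn ℝ f D.support ∧ ∀ x ∈ D.support, f x ∈ Icc c (1 / c)

/-- The assumption on one bias function `b : ℝ≥0 → ℝ≥0` (its values at negative numbers are never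
used): strictly increasing and, on the support of `D`, differentiable (as a function on
`[0, ∞)`), at most `1/c`, with derivative in `[d, 1/c]`. -/
structure IsBiasFunction (c d : ℝ) (D : Measure ℝ) (b : ℝ → ℝ) : Prop where
  strictMonoOn : StrictMonoOn b (Ici 0)
  nonneg : ∀ x, 0 ≤ x → 0 ≤ b x
  differentiable : ∀ x ∈ D.support, DifferentiableWithinAt ℝ b (Ici 0) x
  le_bound : ∀ x ∈ D.support, b x ≤ 1 / c
  deriv_mem : ∀ x ∈ D.support, derivWithin b (Ici 0) x ∈ Icc d (1 / c)

/-- `(b₀₀ - b₁₀ - b₀₁ + b₁₁)(F⁻¹(1 - n/m))`. -/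
def biasContrast (D : Measure ℝ) (b : Bool × Bool → ℝ → ℝ) (n m : ℕ) : ℝ :=
  b (false, false) (quantile D (1 - (n : ℝ) / m)) - b (true, false) (quantile D (1 - (n : ℝ) / m))
    - b (false, true) (quantile D (1 - (n : ℝ) / m)) + b (true, true) (quantile D (1 - (n : ℝ) / m))

/-- The gap `φ_b`, as a function of the contrast `B = (b₀₀ - b₁₀ - b₀₁ + b₁₁)(F⁻¹(1 - n/m))`. -/
def gap (c η ρ B : ℝ) : ℝ :=
  (c ^ 4 * ρ * min η (1 - η) * B) ^ 2

/-- `⟨x̃, w⟩ / ⟨x⋆, w⟩` for the selection rules `x̃` and `x⋆`. -/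
def ratio {m : ℕ} (xt xs : (Fin m → ℝ) → Finset (Fin m)) (w : Fin m → ℝ) : ℝ :=
  utility (xt w) w / utility (xs w) w

/-- The utility ratio: the expectation of `⟨x̃, w⟩ / ⟨x⋆, w⟩` over the latent utilities. -/
def utilityRatio {m : ℕ} (D : Measure ℝ) (xt xs : (Fin m → ℝ) → Finset (Fin m)) : ℝ :=
  ∫ w, ratio xt xs w ∂(latentLaw m D)

end Selection

end

/-!
Write `p = n / m`, let `q` be the quantile of `1 - p` and `B` the contrast at `q`; by symmetry let
`B > 0`.

Exchanging two selected items of the intersections `10` and `01` for two unselected items of `00`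
and `11` changes none of the numbers to which the lower bounds refer. Hence, in an optimal feasible
selection, unselected items of utilities `x`, `x'` in `00` and `11` and selected items of utilities
`y`, `y'` in `10` and `01` satisfy `b₀₀ x + b₁₁ x' ≤ b₁₀ y + b₀₁ y'`. As the bias functions are
`1/c`-Lipschitz, this is impossible if `x, x' > q - cB/4` and `y, y' < q + cB/4`. So there is an
intersection in which either all items above `q - cB/4` are selected or all items below `q + cB/4`
are rejected (`exists_forall_mem_or_forall_notMem`). Compared to the selection of the items above
`q`, which up to the fluctuation of their number is optimal for the latent utility, the selection
then loses the sum of `|w i - q|` over the items `i` of this intersection that lie within `cB/4`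
of `q` on the wrong side (`exists_utility_le_sub_shortfall`).

The density bounds give a lower bound for the expectation of this sum
(`IsLatentDistribution.min_le_integral_shortfall`) and an upper bound for the expected utility of
the items above `q` (`IsLatentDistribution.mul_add_integral_max_le`). Their quotient exceeds the gap
at least by the factor `1 / (1 - η ^ 2)` (`gap_mul_le`). The sums over the items have variance of
order `m`, while the margin left by this factor is of order `m ^ 2` for squared deviations, so for large `m`
the deviations do not use up the margin (`le_one_sub_add_sq`, `utilityRatio_le`).

The ratio is integrable because ties between selections are null events (`ae_utility_ne`), so
that both selection rules agree almost surely with measurable ones.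
-/

noncomputable section

namespace Selection

/-! ### Exchanging selected items -/

theorem sum_insert_insert_erase_erase {ι M : Type*} [DecidableEq ι] [AddCommGroup M]
    {S : Finset ι} {i j k l : ι} (hi : i ∉ S) (hj : j ∉ S) (hij : i ≠ j)
    (hk : k ∈ S) (hl : l ∈ S) (hkl : k ≠ l) (v : ι → M) :
    ∑ x ∈ insert i (insert j ((S.erase k).erase l)), v x
      = ∑ x ∈ S, v x - v k - v l + v i + v j := by
  have hl' : l ∈ S.erase k := Finset.mem_erase.2 ⟨hkl.symm, hl⟩
  rw [Finset.sum_insert (by simp [hi, hij]), Finset.sum_insert (by simp [hj]),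
    ← Finset.add_sum_erase S v hk, ← Finset.add_sum_erase _ v hl']
  abel

theorem card_eq_sum_one_int {ι : Type*} (S : Finset ι) : (S.card : ℤ) = ∑ _x ∈ S, (1 : ℤ) := by
  simp

theorem card_inter_eq_sum_int {ι : Type*} [DecidableEq ι] (S G : Finset ι) :
    ((S ∩ G).card : ℤ) = ∑ x ∈ S, ((decide (x ∈ G)).toNat : ℤ) := by
  rw [← Finset.filter_mem_eq_inter, Finset.card_filter]
  push_cast
  refine Finset.sum_congr rfl fun x _ => ?_
  by_cases h : x ∈ G <;> simp [h]

/-- An exchange of two selected for two unselected items that keeps the number of members of each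
group in the selection does not increase the observed utility of an optimal selection. -/
theorem IsConstrainedOptimal.add_le_add {m n L₁ L₂ : ℕ} {G₁ G₂ : Finset (Fin m)}
    {u : Fin m → ℝ} {S : Finset (Fin m)} (h : IsConstrainedOptimal n L₁ L₂ G₁ G₂ u S)
    {i j k l : Fin m} (hi : i ∉ S) (hj : j ∉ S) (hij : i ≠ j) (hk : k ∈ S) (hl : l ∈ S)
    (hkl : k ≠ l)
    (h₁ : (decide (i ∈ G₁)).toNat + (decide (j ∈ G₁)).toNat
      = (decide (k ∈ G₁)).toNat + (decide (l ∈ G₁)).toNat)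
    (h₂ : (decide (i ∈ G₂)).toNat + (decide (j ∈ G₂)).toNat
      = (decide (k ∈ G₂)).toNat + (decide (l ∈ G₂)).toNat) :
    u i + u j ≤ u k + u l := by
  obtain ⟨⟨hn, hG₁, hG₂⟩, hmax⟩ := h
  have key : ∀ {M : Type} [AddCommGroup M] (v : Fin m → M), _ :=
    fun {M} _ v => sum_insert_insert_erase_erase hi hj hij hk hl hkl v
  set T := insert i (insert j ((S.erase k).erase l)) with hT
  have hu := hmax T ⟨by
      have := key fun _ => (1 : ℤ)
      rw [← card_eq_sum_one_int, ← card_eq_sum_one_int] at this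
      omega, by
      have := key fun x => ((decide (x ∈ G₁)).toNat : ℤ)
      rw [← card_inter_eq_sum_int, ← card_inter_eq_sum_int] at this
      omega, by
      have := key fun x => ((decide (x ∈ G₂)).toNat : ℤ)
      rw [← card_inter_eq_sum_int, ← card_inter_eq_sum_int] at this
      omega⟩
  have := key u
  unfold utility at hu
  linarith

/-! ### The utility lost by an optimal selection -/

/-- The intersections `00, 11` if `s` is true, and `10, 01` otherwise: these are the intersections
that enter the contrast `b₀₀ - b₁₀ - b₀₁ + b₁₁`, multiplied by `1` or `-1` according to `s`,
with a plus sign. -/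
def positivePart (s : Bool) : Finset (Bool × Bool) :=
  {(false, !s), (true, s)}

/-- The contrast `b₀₀ - b₁₀ - b₀₁ + b₁₁` at `q`, multiplied by `1` if `s` is true and by `-1`
otherwise. -/
def signedContrast (b : Bool × Bool → ℝ → ℝ) (s : Bool) (q : ℝ) : ℝ :=
  b (false, !s) q + b (true, s) q - b (true, !s) q - b (false, s) q

/-- The utility, relative to the cutoff `q`, that an item of utility `x` and intersection `σ`
costs when it is treated against the cutoff. If `σ` is in `P`, all items above `q - h` are selected,
and an item in `(q - h, q)` costs `q - x`; otherwise no item below `q + h` is selected,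
and an item in `(q, q + h)` costs `x - q`. -/
def shortfall (P : Finset (Bool × Bool)) (q h : ℝ) (σ : Bool × Bool) : ℝ → ℝ :=
  if σ ∈ P then (Ioo (q - h) q).indicator fun x => q - x
  else (Ioo q (q + h)).indicator fun x => x - q

theorem mem_intersectionSet {m : ℕ} {G₁ G₂ : Finset (Fin m)} {σ : Bool × Bool} {i : Fin m} :
    i ∈ intersectionSet G₁ G₂ σ ↔ decide (i ∈ G₁) = σ.1 ∧ decide (i ∈ G₂) = σ.2 := by
  simp [intersectionSet, intersectionOf, Prod.ext_iff]

theorem IsBiasFunction.sub_le {c d : ℝ} {D : Measure ℝ} {b : ℝ → ℝ} (hd : 0 < d)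
    (hD : IsLatentDistribution c D) (hb : IsBiasFunction c d D b) {x y : ℝ}
    (hx : x ∈ D.support) (hy : y ∈ D.support) (hxy : x ≤ y) : b y - b x ≤ 1 / c * (y - x) := by
  have h := Convex.norm_image_sub_le_of_norm_hasDerivWithin_le (C := 1 / c) (s := D.support)
    (f := b) (f' := derivWithin b (Ici 0))
    (fun z hz => ((hb.differentiable z hz).hasDerivWithinAt).mono
      fun t ht => (hD.support_subset ht).1)
    (fun z hz => by
      have := hb.deriv_mem z hz
      rw [Real.norm_eq_abs, abs_of_nonneg (hd.le.trans this.1)]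
      exact this.2)
    hD.ordConnected_support.convex hx hy
  rw [Real.norm_eq_abs, Real.norm_eq_abs, abs_of_nonneg (sub_nonneg.2 hxy)] at h
  exact (le_abs_self _).trans h

/-- An item whose utility is less than `cB/4` above that of another one exceeds it by less than
`B/4` in biased utility. The first item may also be far below the second. -/
theorem IsBiasFunction.lt_add {c d : ℝ} {D : Measure ℝ} {b : ℝ → ℝ} (hc : 0 < c) (hd : 0 < d)
    (hD : IsLatentDistribution c D) (hb : IsBiasFunction c d D b) {x y B : ℝ} (hB : 0 < B)
    (hx : x ∈ D.support) (hy : y ∈ D.support) (hxy : y < x + c * B / 4) : b y < b x + B / 4 := by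
  rcases le_total x y with h | h
  · have h1 := hb.sub_le hd hD hx hy h
    have h2 : 1 / c * (y - x) < 1 / c * (c * B / 4) :=
      mul_lt_mul_of_pos_left (by linarith) (by positivity)
    have h3 : 1 / c * (c * B / 4) = B / 4 := by field_simp
    linarith
  · have := hb.strictMonoOn.monotoneOn (hD.support_subset hy).1 (hD.support_subset hx).1 h
    linarith

/-- If the contrast at the cutoff `q` is positive, an optimal selection cannot be close to
the selection by the cutoff `q` in all four intersections: in one of them, either all items that
are not far below `q` are selected, or all items that are not far above `q` are rejected. -/
theorem exists_forall_mem_or_forall_notMem {c d : ℝ} {D : Measure ℝ} {b : Bool × Bool → ℝ → ℝ}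
    (hc : 0 < c) (hd : 0 < d) (hD : IsLatentDistribution c D)
    (hb : ∀ σ, IsBiasFunction c d D (b σ)) {m n L₁ L₂ : ℕ} {G₁ G₂ : Finset (Fin m)}
    {w : Fin m → ℝ} {S : Finset (Fin m)} {q B : ℝ} (s : Bool)
    (hB : 0 < B) (hBs : B = signedContrast b s q) (hq : q ∈ D.support)
    (hw : ∀ i, w i ∈ D.support)
    (hS : IsConstrainedOptimal n L₁ L₂ G₁ G₂ (observed b G₁ G₂ w) S) :
    ∃ σ, (σ ∈ positivePart s ∧ ∀ i ∈ intersectionSet G₁ G₂ σ, q - c * B / 4 < w i → i ∈ S) ∨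
      (σ ∉ positivePart s ∧ ∀ i ∈ intersectionSet G₁ G₂ σ, w i < q + c * B / 4 → i ∉ S) := by
  by_contra! H
  obtain ⟨i, hi, hwi, hiS⟩ := (H (false, !s)).1 (by simp [positivePart])
  obtain ⟨j, hj, hwj, hjS⟩ := (H (true, s)).1 (by simp [positivePart])
  obtain ⟨k, hk, hwk, hkS⟩ := (H (true, !s)).2 (by cases s <;> simp [positivePart])
  obtain ⟨l, hl, hwl, hlS⟩ := (H (false, s)).2 (by cases s <;> simp [positivePart])
  have lower : ∀ σ x, x ∈ D.support → q - c * B / 4 < x → b σ q - B / 4 < b σ x := by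
    intro σ x hx hqx
    linarith [(hb σ).lt_add hc hd hD hB hx hq (by linarith)]
  have hi' := lower (false, !s) _ (hw i) hwi
  have hj' := lower (true, s) _ (hw j) hwj
  have hk' := (hb (true, !s)).lt_add hc hd hD hB hq (hw k) hwk
  have hl' := (hb (false, s)).lt_add hc hd hD hB hq (hw l) hwl
  rw [mem_intersectionSet] at hi hj hk hl
  have hexch := hS.add_le_add hiS hjS (by rintro rfl; simp_all) hkS hlS (by rintro rfl; simp_all)
    (by rw [hi.1, hj.1, hk.1, hl.1]; simp)
    (by rw [hi.2, hj.2, hk.2, hl.2])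
  simp only [observed, intersectionOf, hi.1, hi.2, hj.1, hj.2, hk.1, hk.2, hl.1, hl.2] at hexch
  rw [signedContrast] at hBs
  linarith

theorem utility_eq_mul_add {m n : ℕ} {S : Finset (Fin m)} (hS : S.card = n) (w : Fin m → ℝ)
    (q : ℝ) : utility S w = n * q + ∑ i ∈ S, (w i - q) := by
  simp [utility, Finset.sum_sub_distrib, hS]

theorem utility_le_mul_add {m n : ℕ} {S : Finset (Fin m)} (hS : S.card = n) (w : Fin m → ℝ)
    (q : ℝ) : utility S w ≤ n * q + ∑ i, max (w i - q) 0 := by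
  rw [utility_eq_mul_add hS w q]
  gcongr
  exact (Finset.sum_le_sum fun i _ => le_max_left _ _).trans
    (Finset.sum_le_univ_sum_of_nonneg fun i => le_max_right _ _)

/-- In one of the four intersections, an optimal selection loses the whole shortfall, compared to
the (not necessarily feasible) selection of the items above the cutoff `q`. -/
theorem exists_utility_le_sub_shortfall {c d : ℝ} {D : Measure ℝ} {b : Bool × Bool → ℝ → ℝ}
    (hc : 0 < c) (hd : 0 < d) (hD : IsLatentDistribution c D)
    (hb : ∀ σ, IsBiasFunction c d D (b σ)) {m n L₁ L₂ : ℕ} {G₁ G₂ : Finset (Fin m)}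
    {w : Fin m → ℝ} {S : Finset (Fin m)} {q B : ℝ} (s : Bool)
    (hB : 0 < B) (hBs : B = signedContrast b s q) (hq : q ∈ D.support)
    (hw : ∀ i, w i ∈ D.support)
    (hS : IsConstrainedOptimal n L₁ L₂ G₁ G₂ (observed b G₁ G₂ w) S) :
    ∃ σ, utility S w ≤ n * q + ∑ i, max (w i - q) 0
      - ∑ i ∈ intersectionSet G₁ G₂ σ, shortfall (positivePart s) q (c * B / 4) σ (w i) := by
  obtain ⟨σ, hσ⟩ := exists_forall_mem_or_forall_notMem hc hd hD hb s hB hBs hq hw hS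
  refine ⟨σ, ?_⟩
  rw [utility_eq_mul_add hS.1.1 w q, add_sub_assoc]
  gcongr
  rw [← Finset.sum_indicator_subset _ (Finset.subset_univ S),
    ← Finset.sum_indicator_subset _ (Finset.subset_univ (intersectionSet G₁ G₂ σ)),
    ← Finset.sum_sub_distrib]
  refine Finset.sum_le_sum fun i _ => ?_
  by_cases hi : i ∈ intersectionSet G₁ G₂ σ
  · rw [Set.indicator_of_mem (Finset.mem_coe.2 hi)]
    rcases hσ with ⟨hP, h⟩ | ⟨hP, h⟩
    · rw [shortfall, if_pos hP]
      by_cases hx : w i ∈ Ioo (q - c * B / 4) q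
      · rw [Set.indicator_of_mem (Finset.mem_coe.2 (h i hi hx.1)), Set.indicator_of_mem hx]
        linarith [le_max_right (w i - q) 0]
      · rw [Set.indicator_of_notMem hx, sub_zero]
        exact Set.indicator_apply_le' (fun _ => le_max_left _ _) fun _ => le_max_right _ _
    · rw [shortfall, if_neg hP]
      by_cases hx : w i ∈ Ioo q (q + c * B / 4)
      · rw [Set.indicator_of_notMem (mt Finset.mem_coe.1 (h i hi hx.2)), Set.indicator_of_mem hx]
        linarith [le_max_left (w i - q) 0]
      · rw [Set.indicator_of_notMem hx, sub_zero]
        exact Set.indicator_apply_le' (fun _ => le_max_left _ _) fun _ => le_max_right _ _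
  · rw [Set.indicator_of_notMem (mt Finset.mem_coe.1 hi), sub_zero]
    exact Set.indicator_apply_le' (fun _ => le_max_left _ _) fun _ => le_max_right _ _

/-- A latent-optimal selection is at least as good as the selection of the items above `q`,
corrected by `r` for every item by which the number of these differs from `n`. -/
theorem IsLatentOptimal.sub_le_utility {m n : ℕ} {w : Fin m → ℝ} {S : Finset (Fin m)} {q r : ℝ}
    (hnm : n ≤ m) (hS : IsLatentOptimal n w S) (hr : ∀ i, |w i - q| ≤ r) :
    n * q + ∑ i, max (w i - q) 0 - |∑ i, (Ioi q).indicator (fun _ => r) (w i) - n * r|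
      ≤ utility S w := by
  set N : Finset (Fin m) := Finset.univ.filter fun i => q < w i with hN
  have hpos : ∑ i, max (w i - q) 0 = ∑ i ∈ N, (w i - q) := by
    rw [hN, Finset.sum_filter]
    refine Finset.sum_congr rfl fun i _ => ?_
    split_ifs with h
    · exact max_eq_left (by linarith)
    · exact max_eq_right (by linarith)
  have hcount : ∑ i, (Ioi q).indicator (fun _ => r) (w i) = N.card * r := by
    rw [hN, ← nsmul_eq_mul, ← Finset.sum_const, Finset.sum_filter]
    rfl
  have hbound : ∀ T : Finset (Fin m), |∑ i ∈ T, (w i - q)| ≤ T.card * r := fun T =>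
    (Finset.abs_sum_le_sum_abs _ _).trans <|
      (Finset.sum_le_sum fun i _ => hr i).trans (by simp)
  rw [hpos, hcount]
  rcases le_total N.card n with h | h
  · obtain ⟨T, hNT, -, hT⟩ := Finset.exists_subsuperset_card_eq (Finset.subset_univ N) h
      (by simpa using hnm)
    have h1 := hS.2 T hT
    rw [utility_eq_mul_add hT w q, ← Finset.sum_sdiff hNT] at h1
    have h2 := neg_le_of_abs_le (hbound (T \ N))
    rw [Finset.card_sdiff_of_subset hNT, hT, Nat.cast_sub h] at h2
    have h3 := neg_abs_le ((N.card : ℝ) * r - n * r)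
    linarith
  · obtain ⟨T, hNT, hT⟩ := Finset.exists_subset_card_eq h
    have h1 := hS.2 T hT
    have h4 := Finset.sum_sdiff (f := fun i => w i - q) hNT
    rw [utility_eq_mul_add hT w q] at h1
    have h2 := le_of_abs_le (hbound (N \ T))
    rw [Finset.card_sdiff_of_subset hNT, hT, Nat.cast_sub h] at h2
    have h3 := le_abs_self ((N.card : ℝ) * r - n * r)
    linarith

/-! ### The latent distribution and its quantiles -/

namespace IsLatentDistribution

variable {c : ℝ} {D : Measure ℝ}

theorem le_smul_volume (hD : IsLatentDistribution c D) :
    D ≤ ENNReal.ofReal (1 / c) • volume := by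
  obtain ⟨f, hf, -, hDf, -, hfc⟩ := hD.exists_density
  refine Measure.le_iff.2 fun s hs => ?_
  have hsupp : MeasurableSet D.support := Measure.isClosed_support.measurableSet
  calc D s ≤ D (s ∩ D.support) + D (D.supportᶜ) := by
        refine (measure_mono fun x hx => ?_).trans (measure_union_le _ _)
        by_cases h : x ∈ D.support
        · exact Or.inl ⟨hx, h⟩
        · exact Or.inr h
    _ = D (s ∩ D.support) := by rw [Measure.measure_compl_support, add_zero]
    _ = ∫⁻ x in s ∩ D.support, ENNReal.ofReal (f x) := by
        conv_lhs => rw [hDf]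
        rw [withDensity_apply _ (hDf ▸ hs.inter hsupp), ← hDf]
    _ ≤ ∫⁻ _ in s ∩ D.support, ENNReal.ofReal (1 / c) :=
        setLIntegral_mono measurable_const fun x hx => ENNReal.ofReal_le_ofReal (hfc x hx.2).2
    _ ≤ ENNReal.ofReal (1 / c) * volume s := by
        rw [setLIntegral_const]
        gcongr
        exact inter_subset_left

theorem smul_restrict_support_le (hD : IsLatentDistribution c D) :
    ENNReal.ofReal c • volume.restrict D.support ≤ D := by
  obtain ⟨f, hf, -, hDf, -, hfc⟩ := hD.exists_density
  refine Measure.le_iff.2 fun s hs => ?_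
  have hsupp : MeasurableSet D.support := Measure.isClosed_support.measurableSet
  calc ENNReal.ofReal c * volume.restrict D.support s
      = ∫⁻ _ in s ∩ D.support, ENNReal.ofReal c := by
        rw [setLIntegral_const, Measure.restrict_apply hs]
    _ ≤ ∫⁻ x in s ∩ D.support, ENNReal.ofReal (f x) :=
        setLIntegral_mono hf.ennreal_ofReal fun x hx => ENNReal.ofReal_le_ofReal (hfc x hx.2).1
    _ ≤ ∫⁻ x in s, ENNReal.ofReal (f x) := lintegral_mono_set inter_subset_left
    _ = D s := by rw [← withDensity_apply _ hs, ← hDf]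

theorem nullSingletonClass (hD : IsLatentDistribution c D) : NullSingletonClass D :=
  ⟨fun x => le_antisymm ((hD.le_smul_volume {x}).trans (by simp)) zero_le⟩

theorem ae_mem_support : ∀ᵐ x ∂D, x ∈ D.support := Measure.support_mem_ae

theorem ae_mem_Icc (hD : IsLatentDistribution c D) : ∀ᵐ x ∂D, x ∈ Icc 0 (1 / c) :=
  ae_mem_support.mono fun _ hx => hD.support_subset hx

theorem le_one (hc : 0 < c) (hD : IsLatentDistribution c D) : c ≤ 1 := by
  have := hD.isProbabilityMeasure
  have h1 : (1 : ENNReal) ≤ ENNReal.ofReal (1 / c * (1 / c)) := by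
    calc (1 : ENNReal) = D (Icc 0 (1 / c)) :=
          ((prob_compl_eq_zero_iff measurableSet_Icc).1 hD.ae_mem_Icc).symm
      _ ≤ (ENNReal.ofReal (1 / c) • volume) (Icc 0 (1 / c)) := hD.le_smul_volume _
      _ = ENNReal.ofReal (1 / c * (1 / c)) := by
        rw [Measure.smul_apply, Real.volume_Icc, smul_eq_mul, sub_zero,
          ENNReal.ofReal_mul (by positivity)]
  rw [ENNReal.one_le_ofReal, ← sq] at h1
  by_contra! h
  have : 1 / c < 1 := (div_lt_one hc).2 h
  nlinarith [one_div_pos.2 hc]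

theorem integrable_of_bounded (hD : IsLatentDistribution c D) {g : ℝ → ℝ} (hg : Measurable g)
    {a b : ℝ} (h : ∀ x ∈ Icc 0 (1 / c), g x ∈ Icc a b) : Integrable g D :=
  have := hD.isProbabilityMeasure
  Integrable.of_mem_Icc a b hg.aemeasurable (hD.ae_mem_Icc.mono h)

theorem real_Ioc_eq_cdf_sub [IsProbabilityMeasure D] {x y : ℝ} (h : x ≤ y) :
    D.real (Ioc x y) = cdf D y - cdf D x := by
  rw [cdf_eq_real, cdf_eq_real, ← Iic_sdiff_Iic, measureReal_sdiff (Iic_subset_Iic.2 h)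
    measurableSet_Iic]

theorem continuous_cdf (hc : 0 < c) (hD : IsLatentDistribution c D) : Continuous (cdf D) := by
  have := hD.isProbabilityMeasure
  refine (LipschitzWith.of_le_add_mul (K := ⟨1 / c, by positivity⟩) fun x y => ?_).continuous
  rcases le_total x y with h | h
  · exact (monotone_cdf D h).trans
      (le_add_of_nonneg_right (mul_nonneg (one_div_pos.2 hc).le dist_nonneg))
  · have h1 := real_Ioc_eq_cdf_sub (D := D) h
    have h2 : D.real (Ioc y x) ≤ 1 / c * (x - y) := by
      refine ENNReal.toReal_le_of_le_ofReal (by have := sub_nonneg.2 h; positivity) ?_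
      refine (hD.le_smul_volume _).trans ?_
      rw [Measure.smul_apply, Real.volume_Ioc, smul_eq_mul, ENNReal.ofReal_mul (by positivity)]
    rw [Real.dist_eq, abs_of_nonneg (sub_nonneg.2 h)]
    change _ ≤ _ + 1 / c * (x - y)
    linarith

theorem cdf_lt_of_lt_quantile {r x : ℝ} (hr : 0 < r)
    (hx : x < quantile D r) : cdf D x < r := by
  by_contra! h
  have h' : x ∈ {x : ℝ | r ≤ cdf D x} := h
  refine (csInf_le ?_ h').not_gt hx
  obtain ⟨y, hy⟩ := ((tendsto_cdf_atBot D).eventually (gt_mem_nhds hr)).exists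
  exact ⟨y, fun z hz => le_of_not_gt fun hzy =>
    ((monotone_cdf D hzy.le).trans_lt hy).not_ge hz⟩

theorem cdf_quantile (hc : 0 < c) (hD : IsLatentDistribution c D) {r : ℝ} (hr : 0 < r)
    (hr' : r < 1) : cdf D (quantile D r) = r := by
  have hcont := hD.continuous_cdf hc
  refine le_antisymm ?_ ?_
  · refine le_of_tendsto (hcont.continuousWithinAt (s := Iio (quantile D r))) ?_
    exact eventually_nhdsWithin_of_forall fun x hx => (cdf_lt_of_lt_quantile hr hx).le
  · refine IsClosed.csInf_mem (s := {x : ℝ | r ≤ cdf D x})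
      (isClosed_le continuous_const hcont) ?_ ?_
    · exact ((tendsto_cdf_atTop D).eventually (lt_mem_nhds hr')).exists.imp fun _ h => h.le
    · obtain ⟨y, hy⟩ := ((tendsto_cdf_atBot D).eventually (gt_mem_nhds hr)).exists
      exact ⟨y, fun z hz => le_of_not_gt fun hzy =>
        ((monotone_cdf D hzy.le).trans_lt hy).not_ge hz⟩

theorem quantile_mem_support (hc : 0 < c) (hD : IsLatentDistribution c D) {r : ℝ} (hr : 0 < r)
    (hr' : r < 1) : quantile D r ∈ D.support := by
  have := hD.isProbabilityMeasure
  by_contra h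
  obtain ⟨U, hU, hU0⟩ := Measure.notMem_support_iff_exists.1 h
  obtain ⟨ε, hε, hεU⟩ := Metric.mem_nhds_iff.1 hU
  set q := quantile D r
  have h1 : D.real (Ioc (q - ε / 2) q) = 0 := by
    rw [measureReal_def, measure_mono_null _ hU0, ENNReal.toReal_zero]
    refine subset_trans (fun x hx => ?_) hεU
    rw [Metric.mem_ball, Real.dist_eq, abs_lt]
    constructor <;> linarith [hx.1, hx.2]
  have h2 := real_Ioc_eq_cdf_sub (D := D) (show q - ε / 2 ≤ q by linarith)
  have h3 : cdf D (q - ε / 2) < r := cdf_lt_of_lt_quantile hr (by linarith)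
  have h4 : cdf D q = r := hD.cdf_quantile hc hr hr'
  linarith

theorem real_Iio_quantile (hc : 0 < c) (hD : IsLatentDistribution c D) {r : ℝ} (hr : 0 < r)
    (hr' : r < 1) : D.real (Iio (quantile D r)) = r := by
  have := hD.isProbabilityMeasure
  have := hD.nullSingletonClass
  rw [measureReal_congr Iio_ae_eq_Iic, ← cdf_eq_real, hD.cdf_quantile hc hr hr']

theorem real_Ioi_quantile (hc : 0 < c) (hD : IsLatentDistribution c D) {r : ℝ} (hr : 0 < r)
    (hr' : r < 1) : D.real (Ioi (quantile D r)) = 1 - r := by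
  have := hD.isProbabilityMeasure
  rw [← compl_Iic, probReal_compl_eq_one_sub measurableSet_Iic, ← cdf_eq_real,
    hD.cdf_quantile hc hr hr']

/-! ### Truncated first moments -/

theorem setIntegral_volume_le (hc : 0 < c) (hD : IsLatentDistribution c D) {J : Set ℝ} {g : ℝ → ℝ}
    (hJ : MeasurableSet J) (hJs : J ⊆ D.support) (hg : ∀ x ∈ J, 0 ≤ g x)
    (hgi : IntegrableOn g J D) : c * ∫ x in J, g x ≤ ∫ x in J, g x ∂D := by
  have hle : (ENNReal.ofReal c • volume.restrict D.support).restrict J ≤ D.restrict J :=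
    Measure.restrict_mono subset_rfl hD.smul_restrict_support_le
  have := integral_mono_measure hle ((ae_restrict_iff' hJ).2 (ae_of_all _ hg)) hgi
  rwa [Measure.restrict_smul, integral_smul_measure, Measure.restrict_restrict hJ,
    inter_eq_left.2 hJs, ENNReal.toReal_ofReal hc.le, smul_eq_mul] at this

/-- A set of mass `a` cannot be concentrated too much, as the density is at most `1/c`. The
function `F` measures by how much `g` stays below the level `c a`. -/
theorem mul_sq_le_setIntegral (hc : 0 < c) (hD : IsLatentDistribution c D) {A : Set ℝ}
    {g F : ℝ → ℝ} (hA : MeasurableSet A) (hgi : IntegrableOn g A D) (hF : ∀ x, 0 ≤ F x)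
    (hFi : Integrable F) (hFv : ∫ x, F x = (c * D.real A) ^ 2 / 2)
    (h : ∀ x ∈ A, c * D.real A ≤ g x + F x) :
    c * D.real A ^ 2 / 2 ≤ ∫ x in A, g x ∂D := by
  have := hD.isProbabilityMeasure
  have hFi' : Integrable F (ENNReal.ofReal (1 / c) • volume) :=
    hFi.smul_measure ENNReal.ofReal_ne_top
  have hFD : Integrable F D := hFi'.mono_measure hD.le_smul_volume
  have h1 : ∫ x in A, F x ∂D ≤ 1 / c * ((c * D.real A) ^ 2 / 2) := by
    calc ∫ x in A, F x ∂D ≤ ∫ x, F x ∂D := setIntegral_le_integral hFD (ae_of_all _ hF)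
      _ ≤ ∫ x, F x ∂(ENNReal.ofReal (1 / c) • volume) :=
        integral_mono_measure hD.le_smul_volume (ae_of_all _ hF) hFi'
      _ = _ := by
        rw [integral_smul_measure, hFv, ENNReal.toReal_ofReal (by positivity), smul_eq_mul]
  have h2 : ∫ _ in A, c * D.real A ∂D ≤ ∫ x in A, (g x + F x) ∂D :=
    setIntegral_mono_on (integrable_const _) (hgi.add hFD.integrableOn) hA h
  rw [integral_add hgi hFD.integrableOn, setIntegral_const, smul_eq_mul] at h2
  have h3 : 1 / c * ((c * D.real A) ^ 2 / 2) = c * D.real A ^ 2 / 2 := by field_simp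
  nlinarith

theorem integral_indicator_sub_left {a κ : ℝ} (hκ : 0 ≤ κ) :
    ∫ x, (Ioc (a - κ) a).indicator (fun x => x - (a - κ)) x = κ ^ 2 / 2 := by
  rw [integral_indicator measurableSet_Ioc, ← intervalIntegral.integral_of_le (by linarith),
    intervalIntegral.integral_sub (by simp) (by simp), integral_id,
    intervalIntegral.integral_const, smul_eq_mul]
  ring

theorem integral_indicator_sub_right {a κ : ℝ} (hκ : 0 ≤ κ) :
    ∫ x, (Ioc a (a + κ)).indicator (fun x => a + κ - x) x = κ ^ 2 / 2 := by
  rw [integral_indicator measurableSet_Ioc, ← intervalIntegral.integral_of_le (by linarith),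
    intervalIntegral.integral_sub (by simp) (by simp), integral_id,
    intervalIntegral.integral_const, smul_eq_mul]
  ring

theorem integrable_indicator_Ioc {f : ℝ → ℝ} (hf : Continuous f) (a b : ℝ) :
    Integrable ((Ioc a b).indicator f) :=
  (integrable_indicator_iff measurableSet_Ioc).2
    ((hf.integrableOn_Icc (a := a) (b := b)).mono_set Ioc_subset_Icc_self)

theorem integrable_sub_const (hD : IsLatentDistribution c D) (r : ℝ) :
    Integrable (fun x => x - r) D :=
  hD.integrable_of_bounded (a := -r) (b := 1 / c - r) (by fun_prop)
    fun x hx => ⟨by linarith [hx.1], by linarith [hx.2]⟩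

theorem integrable_const_sub (hD : IsLatentDistribution c D) (r : ℝ) :
    Integrable (fun x => r - x) D :=
  (hD.integrable_sub_const r).neg.congr (ae_of_all _ fun x => by simp)

theorem mul_sq_le_setIntegral_const_sub (hc : 0 < c) (hD : IsLatentDistribution c D) {A : Set ℝ}
    {r : ℝ} (hA : MeasurableSet A) (hAr : A ⊆ Iic r) :
    c * D.real A ^ 2 / 2 ≤ ∫ x in A, (r - x) ∂D := by
  have hκ : 0 ≤ c * D.real A := by positivity
  refine hD.mul_sq_le_setIntegral hc hA (hD.integrable_const_sub r).integrableOn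
    (F := (Ioc (r - c * D.real A) r).indicator fun x => x - (r - c * D.real A))
    (fun x => indicator_nonneg (fun x hx => by linarith [hx.1]) x)
    (integrable_indicator_Ioc (by fun_prop) _ _) (integral_indicator_sub_left hκ) fun x hx => ?_
  have hxr : x ≤ r := hAr hx
  by_cases h : x ∈ Ioc (r - c * D.real A) r
  · rw [indicator_of_mem h]
    linarith
  · rw [indicator_of_notMem h]
    have : x ≤ r - c * D.real A := by
      by_contra! h'
      exact h ⟨h', hxr⟩
    linarith

theorem mul_sq_le_setIntegral_sub_const (hc : 0 < c) (hD : IsLatentDistribution c D) {A : Set ℝ}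
    {r : ℝ} (hA : MeasurableSet A) (hAr : A ⊆ Ioi r) :
    c * D.real A ^ 2 / 2 ≤ ∫ x in A, (x - r) ∂D := by
  have hκ : 0 ≤ c * D.real A := by positivity
  refine hD.mul_sq_le_setIntegral hc hA (hD.integrable_sub_const r).integrableOn
    (F := (Ioc r (r + c * D.real A)).indicator fun x => r + c * D.real A - x)
    (fun x => indicator_nonneg (fun x hx => by linarith [hx.2]) x)
    (integrable_indicator_Ioc (by fun_prop) _ _) (integral_indicator_sub_right hκ) fun x hx => ?_
  have hxr : r < x := hAr hx
  by_cases h : x ∈ Ioc r (r + c * D.real A)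
  · rw [indicator_of_mem h]
    linarith
  · rw [indicator_of_notMem h]
    have : r + c * D.real A < x := by
      by_contra! h'
      exact h ⟨hxr, h'⟩
    linarith

/-- The expected utility of the items above the quantile `q` of `1 - p`: it is largest when the
distribution has density `1/c` up to the largest possible utility `1/c`. -/
theorem mul_add_integral_max_le (hc : 0 < c) (hD : IsLatentDistribution c D) {p : ℝ} (hp : 0 < p)
    (hp' : p < 1) :
    p * quantile D (1 - p) + ∫ x, max (x - quantile D (1 - p)) 0 ∂D
      ≤ (p - c ^ 2 * p ^ 2 / 2) / c := by
  have := hD.isProbabilityMeasure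
  set q := quantile D (1 - p) with hq
  have hmass : D.real (Ioi q) = p := by
    rw [hq, hD.real_Ioi_quantile hc (by linarith) (by linarith)]
    ring
  have h1 : ∫ x, max (x - q) 0 ∂D = ∫ x in Ioi q, (x - q) ∂D := by
    rw [← integral_indicator measurableSet_Ioi]
    congr with x
    by_cases h : x ∈ Ioi q
    · rw [indicator_of_mem h, max_eq_left (by linarith [mem_Ioi.1 h])]
    · rw [indicator_of_notMem h, max_eq_right (by linarith [notMem_Ioi.1 h])]
  have h2 := hD.mul_sq_le_setIntegral_const_sub hc
    (measurableSet_Ioi.inter measurableSet_Iic : MeasurableSet (Ioi q ∩ Iic (1 / c)))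
    inter_subset_right
  have hae : (Ioi q ∩ Iic (1 / c) : Set ℝ) =ᵐ[D] Ioi q := by
    filter_upwards [hD.ae_mem_Icc] with x hx
    exact propext ⟨fun h => h.1, fun h => ⟨h, hx.2⟩⟩
  rw [measureReal_congr hae, setIntegral_congr_set hae, hmass] at h2
  have h3 : ∫ x in Ioi q, (1 / c - x) ∂D + ∫ x in Ioi q, (x - q) ∂D = p * (1 / c - q) := by
    rw [← integral_add (hD.integrable_const_sub _).integrableOn
      (hD.integrable_sub_const _).integrableOn]
    simp [hmass]
  have h4 : (p - c ^ 2 * p ^ 2 / 2) / c = p * (1 / c) - c * p ^ 2 / 2 := by field_simp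
  rw [h1, h4]
  linarith

/-- The expected shortfall. If the support extends to distance `h` from the quantile, the bound
comes from the density being at least `c`; otherwise all items on one side of the quantile
count. -/
theorem min_le_integral_shortfall (hc : 0 < c) (hD : IsLatentDistribution c D) {p η h : ℝ}
    (hη : 0 < η) (hp : η < p) (hp' : p < 1 - η) (hh : 0 < h) (P : Finset (Bool × Bool))
    (σ : Bool × Bool) :
    min (c * h ^ 2 / 2) (c * η ^ 2 / 2)
      ≤ ∫ x, shortfall P (quantile D (1 - p)) h σ x ∂D := by
  have := hD.isProbabilityMeasure
  set q := quantile D (1 - p) with hq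
  have hqs : q ∈ D.support := hD.quantile_mem_support hc (by linarith) (by linarith)
  rw [shortfall]
  split_ifs with hσ
  · rw [integral_indicator measurableSet_Ioo]
    by_cases hs : q - h ∈ D.support
    · refine (min_le_left _ _).trans ?_
      have h1 := hD.setIntegral_volume_le hc (g := fun x => q - x) measurableSet_Ioo
        ((Ioo_subset_Icc_self).trans (hD.ordConnected_support.out hs hqs))
        (fun x hx => by linarith [hx.2]) (hD.integrable_const_sub q).integrableOn
      refine le_trans (le_of_eq ?_) h1
      have h2 := integral_indicator_sub_right (a := q - h) hh.le
      rw [integral_indicator measurableSet_Ioc, integral_Ioc_eq_integral_Ioo,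
        sub_add_cancel] at h2
      rw [h2]
      ring
    · refine (min_le_right _ _).trans ?_
      have h1 := hD.mul_sq_le_setIntegral_const_sub hc (measurableSet_Ioo (a := q - h) (b := q))
        (fun x hx => hx.2.le)
      have hae : (Ioo (q - h) q : Set ℝ) =ᵐ[D] Iio q := by
        filter_upwards [ae_mem_support (D := D)] with x hx
        refine propext ⟨fun h => h.2, fun h' => ⟨?_, h'⟩⟩
        by_contra! hxq
        exact hs (hD.ordConnected_support.out hx hqs ⟨hxq, by linarith⟩)
      rw [measureReal_congr hae, hq, hD.real_Iio_quantile hc (by linarith) (by linarith),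
        ← hq] at h1
      refine le_trans ?_ h1
      gcongr
      linarith
  · rw [integral_indicator measurableSet_Ioo]
    by_cases hs : q + h ∈ D.support
    · refine (min_le_left _ _).trans ?_
      have h1 := hD.setIntegral_volume_le hc (g := fun x => x - q) measurableSet_Ioo
        ((Ioo_subset_Icc_self).trans (hD.ordConnected_support.out hqs hs))
        (fun x hx => by linarith [hx.1]) (hD.integrable_sub_const q).integrableOn
      refine le_trans (le_of_eq ?_) h1
      have h2 := integral_indicator_sub_left (a := q + h) hh.le
      rw [integral_indicator measurableSet_Ioc, integral_Ioc_eq_integral_Ioo,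
        add_sub_cancel_right] at h2
      rw [h2]
      ring
    · refine (min_le_right _ _).trans ?_
      have h1 := hD.mul_sq_le_setIntegral_sub_const hc (measurableSet_Ioo (a := q) (b := q + h))
        (fun x hx => hx.1)
      have hae : (Ioo q (q + h) : Set ℝ) =ᵐ[D] Ioi q := by
        filter_upwards [ae_mem_support (D := D)] with x hx
        refine propext ⟨fun h => h.1, fun h' => ⟨h', ?_⟩⟩
        by_contra! hxq
        exact hs (hD.ordConnected_support.out hqs hx ⟨by linarith, hxq⟩)
      rw [measureReal_congr hae, hq, hD.real_Ioi_quantile hc (by linarith) (by linarith),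
        ← hq] at h1
      refine le_trans ?_ h1
      gcongr
      linarith

end IsLatentDistribution

/-! ### Second moments of sums over items -/

/-- The deviation of the sum of `g (w i)` over the items `i ∈ A` from its expectation. -/
def deviation {m : ℕ} (D : Measure ℝ) (A : Finset (Fin m)) (g : ℝ → ℝ) (w : Fin m → ℝ) : ℝ :=
  ∑ i ∈ A, g (w i) - A.card * ∫ x, g x ∂D

theorem isProbabilityMeasure_latentLaw (m : ℕ) (D : Measure ℝ) [IsProbabilityMeasure D] :
    IsProbabilityMeasure (latentLaw m D) := by
  unfold latentLaw
  infer_instance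

theorem ae_latentLaw_forall {m : ℕ} {D : Measure ℝ} [IsProbabilityMeasure D] {p : ℝ → Prop}
    (h : ∀ᵐ x ∂D, p x) : ∀ᵐ w ∂(latentLaw m D), ∀ i, p (w i) :=
  ae_all_iff.2 fun i => (Measure.quasiMeasurePreserving_eval (fun _ => D) i).ae h

/-- By independence, the second moment of the deviation is at most the sum of the variances. -/
theorem integrable_deviation_sq_and_le {m : ℕ} {D : Measure ℝ} [IsProbabilityMeasure D]
    (A : Finset (Fin m)) {g : ℝ → ℝ} (hg : Measurable g) {M : ℝ}
    (hgM : ∀ᵐ x ∂D, g x ∈ Icc 0 M) :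
    Integrable (fun w => deviation D A g w ^ 2) (latentLaw m D) ∧
      ∫ w, deviation D A g w ^ 2 ∂(latentLaw m D) ≤ m * (M / 2) ^ 2 := by
  have := isProbabilityMeasure_latentLaw m D
  have hmem : ∀ i, MemLp (fun w : Fin m → ℝ => g (w i)) 2 (latentLaw m D) := fun i =>
    (memLp_of_bounded hgM hg.aestronglyMeasurable 2).comp_measurePreserving
      (measurePreserving_eval (fun _ => D) i)
  have hint : ∀ i, ∫ w : Fin m → ℝ, g (w i) ∂(latentLaw m D) = ∫ x, g x ∂D := fun i =>
    integral_comp_eval (μ := fun _ => D) hg.aestronglyMeasurable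
  have hsum : MemLp (∑ i ∈ A, fun w : Fin m → ℝ => g (w i)) 2 (latentLaw m D) :=
    memLp_finsetSum' A fun i _ => hmem i
  have hmean : ∫ w, (∑ i ∈ A, fun w : Fin m → ℝ => g (w i)) w ∂(latentLaw m D)
      = A.card * ∫ x, g x ∂D := by
    simp only [Finset.sum_apply]
    rw [integral_finsetSum A fun i _ => (hmem i).integrable (by norm_num)]
    simp [hint]
  have hdev : ∀ w, deviation D A g w = (∑ i ∈ A, fun w : Fin m → ℝ => g (w i)) w
      - ∫ w, (∑ i ∈ A, fun w : Fin m → ℝ => g (w i)) w ∂(latentLaw m D) := fun w => by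
    rw [hmean, deviation, Finset.sum_apply]
  have hvar : ∀ i, Var[fun w : Fin m → ℝ => g (w i); latentLaw m D] ≤ (M / 2) ^ 2 := fun i => by
    simpa using variance_le_sq_of_bounded (μ := latentLaw m D) (X := fun w : Fin m → ℝ => g (w i))
      ((Measure.quasiMeasurePreserving_eval (fun _ => D) i).ae hgM)
      (hg.comp (measurable_pi_apply i)).aemeasurable
  have hindep : iIndepFun (fun (i : Fin m) (w : Fin m → ℝ) => g (w i)) (latentLaw m D) :=
    iIndepFun_pi (μ := fun _ => D) fun i => hg.aemeasurable
  refine ⟨?_, ?_⟩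
  · simp only [hdev]
    exact (hsum.sub (memLp_const _)).integrable_sq
  · calc ∫ w, deviation D A g w ^ 2 ∂(latentLaw m D)
        = Var[∑ i ∈ A, fun w : Fin m → ℝ => g (w i); latentLaw m D] := by
          rw [variance_eq_integral hsum.aestronglyMeasurable.aemeasurable]
          simp only [hdev]
      _ = ∑ i ∈ A, Var[fun w : Fin m → ℝ => g (w i); latentLaw m D] :=
          IndepFun.variance_sum (fun i _ => hmem i) fun i _ j _ hij => hindep.indepFun hij
      _ ≤ ∑ _i ∈ A, (M / 2) ^ 2 := Finset.sum_le_sum fun i _ => hvar i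
      _ ≤ m * (M / 2) ^ 2 := by
          rw [Finset.sum_const, nsmul_eq_mul]
          gcongr
          simpa using Finset.card_le_univ A

/-! ### Almost sure uniqueness of the optimal selections -/

/-- The observed utilities of two different selections of the same size almost surely differ: given
the utilities of the other items, a tie fixes that of an item in only one of the selections. -/
theorem ae_utility_ne {c : ℝ} {D : Measure ℝ} (hD : IsLatentDistribution c D) {m : ℕ}
    {v : Fin m → ℝ → ℝ} (hv : ∀ i, Measurable (v i)) (hvs : ∀ i, StrictMonoOn (v i) (Ici 0))
    {S T : Finset (Fin m)} (hST : S.card = T.card) (hne : S ≠ T) :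
    ∀ᵐ w ∂(latentLaw m D), utility S (fun i => v i (w i)) ≠ utility T (fun i => v i (w i)) := by
  have := hD.isProbabilityMeasure
  have := hD.nullSingletonClass
  obtain ⟨i, hiS, hiT⟩ : ∃ i ∈ S, i ∉ T := by
    by_contra! h
    exact hne (Finset.eq_of_subset_of_card_le h hST.ge)
  obtain ⟨k, rfl⟩ : ∃ k, m = k + 1 := ⟨m - 1, by have := i.pos; omega⟩
  have hmp := measurePreserving_piFinSuccAbove (fun _ : Fin (k + 1) => D) i
  set e := MeasurableEquiv.piFinSuccAbove (fun _ : Fin (k + 1) => ℝ) i with he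
  let Y : (Fin (k + 1) → ℝ) → ℝ := fun w =>
    ∑ j ∈ T, v j (w j) - ∑ j ∈ S.erase i, v j (w j)
  have hY : Measurable Y := by fun_prop
  have hYe : ∀ x x' y, Y (e.symm (x, y)) = Y (e.symm (x', y)) := by
    intro x x' y
    have h : ∀ j, j ≠ i → (e.symm (x, y)) j = (e.symm (x', y)) j := by
      intro j hj
      obtain ⟨l, rfl⟩ := Fin.exists_succAbove_eq hj
      simp [he]
    refine congrArg₂ (· - ·) (Finset.sum_congr rfl fun j hj => ?_)
      (Finset.sum_congr rfl fun j hj => ?_)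
    · rw [h j (by rintro rfl; exact hiT hj)]
    · rw [h j (Finset.ne_of_mem_erase hj)]
  have hcrit : ∀ w, utility S (fun j => v j (w j)) = utility T (fun j => v j (w j)) →
      v i (w i) = Y w := by
    intro w h
    rw [utility, ← Finset.add_sum_erase S _ hiS] at h
    simp only [Y]
    rw [utility] at h
    linarith
  have hprod : ∀ᵐ z ∂(D.prod (Measure.pi fun _ : Fin k => D)),
      ¬ (0 ≤ z.1 ∧ v i z.1 = Y (e.symm (z.1, z.2))) := by
    have hmeas : MeasurableSet {z : ℝ × (Fin k → ℝ) | 0 ≤ z.1 ∧ v i z.1 = Y (e.symm (z.1, z.2))} :=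
      (measurableSet_le measurable_const measurable_fst).inter
        (measurableSet_eq_fun ((hv i).comp measurable_fst) (hY.comp e.symm.measurable))
    rw [ae_iff]
    simp only [not_not]
    rw [← Measure.prod_swap, Measure.map_apply measurable_swap hmeas]
    refine (Measure.measure_prod_null (hmeas.preimage measurable_swap)).2 (ae_of_all _ fun y => ?_)
    refine Set.Subsingleton.measure_zero ?_ D
    rintro x ⟨hx0, hx⟩ x' ⟨hx0', hx'⟩
    exact (hvs i).injOn hx0 hx0' (hx.trans ((hYe x x' y).trans hx'.symm))
  have h1 : ∀ᵐ w ∂(latentLaw (k + 1) D), ¬ (0 ≤ w i ∧ v i (w i) = Y w) := by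
    filter_upwards [hmp.quasiMeasurePreserving.ae hprod] with w hw
    rintro ⟨h0, h⟩
    refine hw ⟨h0, ?_⟩
    change v i (w i) = Y (e.symm (e w))
    rw [e.symm_apply_apply]
    exact h
  filter_upwards [h1, ae_latentLaw_forall hD.ae_mem_Icc] with w hw hw0 h
  exact hw ⟨(hw0 i).1, hcrit w h⟩

/-- The selection rule is not assumed measurable: almost surely, it selects the unique optimum. -/
theorem aemeasurable_utility_of_isConstrainedOptimal {c : ℝ} {D : Measure ℝ}
    (hD : IsLatentDistribution c D) {m n L₁ L₂ : ℕ} {G₁ G₂ : Finset (Fin m)}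
    {v : Fin m → ℝ → ℝ} (hvs : ∀ i, StrictMonoOn (v i) (Ici 0))
    {x : (Fin m → ℝ) → Finset (Fin m)}
    (hx : ∀ᵐ w ∂(latentLaw m D),
      IsConstrainedOptimal n L₁ L₂ G₁ G₂ (fun i => v i (w i)) (x w)) :
    AEMeasurable (fun w => utility (x w) w) (latentLaw m D) := by
  have := hD.isProbabilityMeasure
  -- The values of `v` at negative numbers are irrelevant; the modification is monotone on `ℝ`.
  let v' : Fin m → ℝ → ℝ := fun i t => v i (max t 0)
  have hv'm : ∀ i, Measurable (v' i) := fun i => Monotone.measurable fun s t hst =>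
    (hvs i).monotoneOn (mem_Ici.2 (le_max_right _ _)) (mem_Ici.2 (le_max_right _ _))
       (max_le_max_right 0 hst)
  have hv' : ∀ i, ∀ t, 0 ≤ t → v' i t = v i t := fun i t ht => by simp only [v', max_eq_left ht]
  have hv's : ∀ i, StrictMonoOn (v' i) (Ici 0) := fun i => (hvs i).congr fun t ht =>
    (hv' i t ht).symm
  let A : Finset (Fin m) → Set (Fin m → ℝ) := fun S =>
    {w | IsConstrainedOptimal n L₁ L₂ G₁ G₂ (fun i => v' i (w i)) S}
  have hA : ∀ S, MeasurableSet (A S) := by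
    intro S
    have hu : ∀ T : Finset (Fin m), Measurable fun w : Fin m → ℝ =>
        utility T (fun i => v' i (w i)) := fun T => by
      unfold utility
      fun_prop
    simp only [A, IsConstrainedOptimal, ofPred_and, ofPred_forall]
    exact (MeasurableSet.const _).inter (MeasurableSet.iInter fun T =>
      MeasurableSet.iInter fun _ => measurableSet_le (hu T) (hu S))
  refine ⟨fun w => ∑ S, (A S).indicator (utility S) w, ?_, ?_⟩
  · refine Finset.measurable_sum _ fun S _ => Measurable.indicator ?_ (hA S)
    unfold utility
    fun_prop
  · have hties : ∀ᵐ w ∂(latentLaw m D), ∀ S T : Finset (Fin m), S.card = T.card → S ≠ T →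
        utility S (fun i => v' i (w i)) ≠ utility T (fun i => v' i (w i)) := by
      simp only [ae_all_iff]
      intro S T h1 h2
      exact ae_utility_ne hD hv'm hv's h1 h2
    filter_upwards [hties, hx, ae_latentLaw_forall hD.ae_mem_Icc] with w hw hxw hw0
    have hvw : (fun i => v i (w i)) = fun i => v' i (w i) :=
      funext fun i => (hv' i _ (hw0 i).1).symm
    rw [hvw] at hxw
    rw [Finset.sum_eq_single (x w), indicator_of_mem (show w ∈ A (x w) from hxw)]
    · intro S _ hS
      refine indicator_of_notMem (fun hSA : w ∈ A S => ?_) _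
      exact hw S (x w) (hSA.1.1.trans hxw.1.1.symm) hS
        (le_antisymm (hxw.2 S hSA.1) (hSA.2 _ hxw.1))
    · simp

/-! ### Comparison of the constants -/

/-- The total deviation per item up to which the sums determine the relative loss sufficiently
well, when the contrast has absolute value `t`. It is a quarter of `η ^ 2` times a lower bound for
the expected loss per item. -/
def tolerance (c η ρ t : ℝ) : ℝ :=
  c ^ 3 * ρ * η ^ 4 * t ^ 2 / 128

theorem pow_mul_le_one_sub_sq {c η p : ℝ} (hc : 0 < c) (hc1 : c ≤ 1) (hη : 0 < η) (hp : η < p)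
    (hp' : p < 1 - η) : c ^ 4 * (p - c ^ 2 * p ^ 2 / 2) ≤ (1 - η ^ 2) / 2 := by
  have hy : 0 ≤ c ^ 2 := by positivity
  have hy1 : c ^ 2 ≤ 1 := pow_le_one₀ hc.le hc1
  have h1 : 0 ≤ p * ((1 - c ^ 2) * (1 + c ^ 2 * (1 - c ^ 2))) :=
    mul_nonneg (by linarith) (mul_nonneg (by linarith)
      (by linarith [mul_nonneg hy (sub_nonneg.2 hy1)]))
  have h2 : 0 ≤ p * (1 - p) * (1 - (c ^ 2) ^ 3) :=
    mul_nonneg (mul_nonneg (by linarith) (by linarith)) (by linarith [pow_le_one₀ (n := 3) hy hy1])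
  have h3 : 0 ≤ (1 - p - η) * (1 - p + η) := mul_nonneg (by linarith) (by linarith)
  nlinarith

/-- The expected relative loss exceeds the gap by a factor of at least `1 / (1 - η ^ 2)`. -/
theorem gap_mul_le {c η ρ p t : ℝ} (hc : 0 < c) (hc1 : c ≤ 1) (hη : 0 < η) (hp : η < p)
    (hp' : p < 1 - η) (hρ : 0 < ρ) (hρ' : ρ ≤ 1 / 4) (ht : 0 ≤ t) (htc : c * t ≤ 2) :
    (c ^ 4 * ρ * η * t) ^ 2 * ((p - c ^ 2 * p ^ 2 / 2) / c)
      ≤ (1 - η ^ 2) * (ρ * min (c * (c * t / 4) ^ 2 / 2) (c * η ^ 2 / 2)) := by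
  have hu := pow_mul_le_one_sub_sq hc hc1 hη hp hp'
  have hη2 : η ^ 2 ≤ 1 / 4 := by nlinarith
  have hE : 0 ≤ (1 - η ^ 2) / 2 := by linarith
  set u := p - c ^ 2 * p ^ 2 / 2
  rw [← mul_assoc, mul_min_of_nonneg _ _ (by nlinarith : 0 ≤ (1 - η ^ 2) * ρ)]
  refine le_min ?_ ?_
  · calc (c ^ 4 * ρ * η * t) ^ 2 * (u / c)
        = (c ^ 3 * ρ * t ^ 2 * (ρ * η ^ 2)) * (c ^ 4 * u) := by field_simp
      _ ≤ (c ^ 3 * ρ * t ^ 2 * (ρ * η ^ 2)) * ((1 - η ^ 2) / 2) := by gcongr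
      _ ≤ (c ^ 3 * ρ * t ^ 2 * (1 / 4 * (1 / 4))) * ((1 - η ^ 2) / 2) := by gcongr
      _ = (1 - η ^ 2) * ρ * (c * (c * t / 4) ^ 2 / 2) := by ring
  · calc (c ^ 4 * ρ * η * t) ^ 2 * (u / c)
        = ((c * t) ^ 2 * c * ρ * ρ * η ^ 2) * (c ^ 4 * u) := by field_simp
      _ ≤ ((c * t) ^ 2 * c * ρ * ρ * η ^ 2) * ((1 - η ^ 2) / 2) := by gcongr
      _ ≤ (2 ^ 2 * c * ρ * (1 / 4) * η ^ 2) * ((1 - η ^ 2) / 2) := by gcongr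
      _ = (1 - η ^ 2) * ρ * (c * η ^ 2 / 2) := by ring

theorem four_mul_tolerance_le {c η ρ t : ℝ} (hc : 0 < c) (hη : 0 < η) (hη' : η < 1) (hρ : 0 < ρ)
    (ht : 0 ≤ t) (htc : c * t ≤ 2) :
    4 * tolerance c η ρ t ≤ η ^ 2 * (ρ * min (c * (c * t / 4) ^ 2 / 2) (c * η ^ 2 / 2)) := by
  have h : c ^ 3 * η ^ 2 * t ^ 2 / 32 ≤ min (c * (c * t / 4) ^ 2 / 2) (c * η ^ 2 / 2) := by
    refine le_min ?_ ?_
    · calc c ^ 3 * η ^ 2 * t ^ 2 / 32 ≤ c ^ 3 * 1 ^ 2 * t ^ 2 / 32 := by gcongr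
        _ = c * (c * t / 4) ^ 2 / 2 := by ring
    · calc c ^ 3 * η ^ 2 * t ^ 2 / 32 = (c * t) ^ 2 * (c * η ^ 2) / 32 := by ring
        _ ≤ 2 ^ 2 * (c * η ^ 2) / 32 := by gcongr
        _ ≤ c * η ^ 2 / 2 := by nlinarith [mul_pos hc (pow_pos hη 2)]
  calc 4 * tolerance c η ρ t = η ^ 2 * (ρ * (c ^ 3 * η ^ 2 * t ^ 2 / 32)) := by
        rw [tolerance]
        ring
    _ ≤ _ := by gcongr

theorem gap_mul_one_add_le_one {c η ρ t : ℝ} (hc : 0 < c) (hc1 : c ≤ 1) (hη : 0 < η)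
    (hη' : η < 1 / 2) (hρ : 0 < ρ) (hρ' : ρ ≤ 1 / 4) (ht : 0 ≤ t) (htc : c * t ≤ 2) :
    (c ^ 4 * ρ * η * t) ^ 2 * (1 + η ^ 2 / 2) ≤ 1 := by
  calc (c ^ 4 * ρ * η * t) ^ 2 * (1 + η ^ 2 / 2)
      = (c ^ 3 * (c * t) * ρ * η) ^ 2 * (1 + η ^ 2 / 2) := by ring
    _ ≤ (1 ^ 3 * 2 * (1 / 4) * (1 / 2)) ^ 2 * (1 + (1 / 2) ^ 2 / 2) := by gcongr
    _ ≤ 1 := by norm_num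

/-- If the deviations `x`, `y`, `z` of the lost utility, of the number of items above the cutoff
and of the optimal utility are small compared to the expected loss `M`, the relative loss is
close to its expectation. Here `A` is the utility of the items above the cutoff and `U`
bounds its expectation. -/
theorem le_one_sub_mul_of_deviation {Vs Vt A X M U φ η x y z T : ℝ} (hφ : 0 ≤ φ) (hη : 0 ≤ η)
    (hφ1 : φ * (1 + η ^ 2 / 2) ≤ 1) (hVt : Vt ≤ A - X) (hAV : A - |y| ≤ Vs) (hVA : Vs ≤ A)
    (hX : M - |x| ≤ X) (hA : A ≤ U + |z|) (hU : φ * U ≤ (1 - η ^ 2) * M) (hM : 0 ≤ M)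
    (hT : 4 * T ≤ η ^ 2 * M) (hxyz : |x| + |y| + |z| ≤ T) :
    Vt ≤ (1 - φ * (1 + η ^ 2 / 2)) * Vs := by
  have h1 : φ * (1 + η ^ 2 / 2) * Vs ≤ (1 + η ^ 2 / 2) * (φ * U) + |z| := by
    calc φ * (1 + η ^ 2 / 2) * Vs ≤ φ * (1 + η ^ 2 / 2) * (U + |z|) := by
          gcongr
          linarith
      _ = (1 + η ^ 2 / 2) * (φ * U) + φ * (1 + η ^ 2 / 2) * |z| := by ring
      _ ≤ (1 + η ^ 2 / 2) * (φ * U) + 1 * |z| := by gcongr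
      _ = _ := by ring
  have h2 : (1 + η ^ 2 / 2) * (φ * U) ≤ (1 + η ^ 2 / 2) * ((1 - η ^ 2) * M) := by gcongr
  have h3 : (1 + η ^ 2 / 2) * ((1 - η ^ 2) * M) ≤ (1 - η ^ 2 / 2) * M := by
    nlinarith [mul_nonneg (pow_nonneg hη 4) hM]
  nlinarith

/-- Replaces the condition that the deviations are small by an error term that is quadratic in
them: if the condition fails, the error term exceeds the whole loss. -/
theorem le_one_sub_add_sq {r φ η x y z T : ℝ} (hφ : 0 ≤ φ) (hη : 0 ≤ η) (hη1 : η ≤ 1) (hT : 0 < T)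
    (hr : r ≤ 1) (h : |x| + |y| + |z| ≤ T → r ≤ 1 - φ * (1 + η ^ 2 / 2)) :
    r ≤ 1 - φ * (1 + η ^ 2 / 2) + 6 * φ / T ^ 2 * (x ^ 2 + y ^ 2 + z ^ 2) := by
  by_cases hxyz : |x| + |y| + |z| ≤ T
  · exact (h hxyz).trans (le_add_of_nonneg_right (by positivity))
  · have h1 : T ^ 2 ≤ 3 * (x ^ 2 + y ^ 2 + z ^ 2) := by
      rw [← sq_abs x, ← sq_abs y, ← sq_abs z]
      have : T ^ 2 ≤ (|x| + |y| + |z|) ^ 2 := by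
        push Not at hxyz
        gcongr
      nlinarith [sq_nonneg (|x| - |y|), sq_nonneg (|y| - |z|), sq_nonneg (|x| - |z|)]
    have h2 : φ * 2 ≤ 6 * φ / T ^ 2 * (x ^ 2 + y ^ 2 + z ^ 2) := by
      calc φ * 2 = 6 * φ / T ^ 2 * (T ^ 2 / 3) := by
            field_simp
            ring
        _ ≤ _ := by
          gcongr
          linarith
    nlinarith [mul_nonneg hφ (by nlinarith : 0 ≤ 1 - η ^ 2 / 2)]

/-! ### The utility ratio -/

theorem utility_nonneg {m : ℕ} {w : Fin m → ℝ} (hw : ∀ i, 0 ≤ w i) (S : Finset (Fin m)) :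
    0 ≤ utility S w :=
  Finset.sum_nonneg fun i _ => hw i

theorem div_utility_mem_Icc {m n L₁ L₂ : ℕ} {G₁ G₂ : Finset (Fin m)} {w u : Fin m → ℝ}
    {S T : Finset (Fin m)} (hw : ∀ i, 0 ≤ w i) (hS : IsLatentOptimal n w S)
    (hT : IsConstrainedOptimal n L₁ L₂ G₁ G₂ u T) : utility T w / utility S w ∈ Icc 0 1 :=
  ⟨div_nonneg (utility_nonneg hw _) (utility_nonneg hw _),
    div_le_one_of_le₀ (hS.2 T hT.1.1) (utility_nonneg hw _)⟩

/-- An unconstrained optimum is an optimum for trivial lower bounds. -/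
theorem IsLatentOptimal.isConstrainedOptimal {m n : ℕ} {w : Fin m → ℝ} {S : Finset (Fin m)}
    (hS : IsLatentOptimal n w S) : IsConstrainedOptimal n 0 0 ∅ ∅ w S :=
  ⟨⟨hS.1, Nat.zero_le _, Nat.zero_le _⟩, fun T hT => hS.2 T hT.1⟩

theorem integrable_ratio {c d : ℝ} {D : Measure ℝ} (hD : IsLatentDistribution c D)
    {b : Bool × Bool → ℝ → ℝ} (hb : ∀ σ, IsBiasFunction c d D (b σ)) {m n L₁ L₂ : ℕ}
    {G₁ G₂ : Finset (Fin m)} {xt xs : (Fin m → ℝ) → Finset (Fin m)}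
    (hxt : ∀ᵐ w ∂(latentLaw m D),
      IsConstrainedOptimal n L₁ L₂ G₁ G₂ (observed b G₁ G₂ w) (xt w))
    (hxs : ∀ᵐ w ∂(latentLaw m D), IsLatentOptimal n w (xs w)) :
    Integrable (ratio xt xs) (latentLaw m D) := by
  have := hD.isProbabilityMeasure
  have := isProbabilityMeasure_latentLaw m D
  have ht : AEMeasurable (fun w => utility (xt w) w) (latentLaw m D) :=
    aemeasurable_utility_of_isConstrainedOptimal hD
      (v := fun i => b (intersectionOf G₁ G₂ i)) (fun i => (hb _).strictMonoOn) hxt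
  have hs : AEMeasurable (fun w => utility (xs w) w) (latentLaw m D) :=
    aemeasurable_utility_of_isConstrainedOptimal hD
      (v := fun _ t => t) (fun i => strictMonoOn_id)
      (hxs.mono fun w hw => hw.isConstrainedOptimal)
  refine Integrable.of_mem_Icc 0 1 (ht.div hs) ?_
  filter_upwards [hxt, hxs, ae_latentLaw_forall hD.ae_mem_Icc] with w hwt hws hw
  exact div_utility_mem_Icc (fun i => (hw i).1) hws hwt

theorem measurable_shortfall (P : Finset (Bool × Bool)) (q h : ℝ) (σ : Bool × Bool) :
    Measurable (shortfall P q h σ) := by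
  rw [shortfall]
  split_ifs
  · exact Measurable.indicator (by fun_prop) measurableSet_Ioo
  · exact Measurable.indicator (by fun_prop) measurableSet_Ioo

theorem shortfall_mem_Icc {P : Finset (Bool × Bool)} {q h r x : ℝ} {σ : Bool × Bool}
    (hq : q ∈ Icc 0 r) (hx : x ∈ Icc 0 r) : shortfall P q h σ x ∈ Icc 0 r := by
  have hr : 0 ≤ r := hq.1.trans hq.2
  rw [shortfall]
  split_ifs <;> simp only [indicator_apply] <;> split_ifs with hxq
  · exact ⟨by linarith [hxq.2], by linarith [hq.2, hx.1]⟩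
  · exact ⟨le_rfl, hr⟩
  · exact ⟨by linarith [hxq.1], by linarith [hq.1, hx.2]⟩
  · exact ⟨le_rfl, hr⟩

theorem sum_card_intersectionSet {m : ℕ} (G₁ G₂ : Finset (Fin m)) :
    ∑ σ, (intersectionSet G₁ G₂ σ).card = m := by
  have := Finset.card_eq_sum_card_fiberwise (s := (Finset.univ : Finset (Fin m)))
    (t := Finset.univ) (f := intersectionOf G₁ G₂) (fun i _ => by simp)
  simpa [intersectionSet] using this.symm

theorem exists_signedContrast_eq_abs (D : Measure ℝ) (b : Bool × Bool → ℝ → ℝ) (n m : ℕ) :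
    ∃ s, |biasContrast D b n m| = signedContrast b s (quantile D (1 - (n : ℝ) / m)) := by
  rcases le_total 0 (biasContrast D b n m) with h | h
  · refine ⟨true, ?_⟩
    rw [abs_of_nonneg h, biasContrast, signedContrast]
    simp only [Bool.not_true]
    ring
  · refine ⟨false, ?_⟩
    rw [abs_of_nonpos h, biasContrast, signedContrast]
    simp only [Bool.not_false]
    ring

/-- The number of items from which on the gap holds, when the contrast has absolute value `t`:
the variances of the sums involved are then small enough. -/
def threshold (c η ρ t : ℝ) : ℕ :=
  ⌈18 / (c ^ 2 * tolerance c η ρ t ^ 2 * η ^ 2)⌉₊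

theorem antitoneOn_threshold {c η ρ : ℝ} (hc : 0 < c) (hη : 0 < η) (hρ : 0 < ρ) :
    AntitoneOn (threshold c η ρ) (Ioi 0) := by
  intro s hs t ht hst
  have hs : 0 < s := hs
  unfold threshold tolerance
  gcongr

/-- The gap for a nonzero contrast: the pointwise bound with quadratic error is integrated, and the
variances are absorbed by the margin `φ * (η ^ 2 / 2)`. -/
theorem utilityRatio_le {c d η ρ : ℝ} (hc : 0 < c) (hη : 0 < η) (hρ : 0 < ρ) (hd : 0 < d)
    {D : Measure ℝ} (hD : IsLatentDistribution c D)
    {b : Bool × Bool → ℝ → ℝ} (hb : ∀ σ, IsBiasFunction c d D (b σ)) {m n : ℕ}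
    (hp : η < (n : ℝ) / m) (hp' : (n : ℝ) / m < 1 - η) {G₁ G₂ : Finset (Fin m)}
    (hI : ∀ σ, ρ * m ≤ ((intersectionSet G₁ G₂ σ).card : ℝ))
    (hB : biasContrast D b n m ≠ 0) (hm : threshold c η ρ |biasContrast D b n m| ≤ m)
    {L₁ L₂ : ℕ} {xt xs : (Fin m → ℝ) → Finset (Fin m)}
    (hxt : ∀ᵐ w ∂(latentLaw m D),
      IsConstrainedOptimal n L₁ L₂ G₁ G₂ (observed b G₁ G₂ w) (xt w))
    (hxs : ∀ᵐ w ∂(latentLaw m D), IsLatentOptimal n w (xs w)) :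
    utilityRatio D xt xs ≤ 1 - gap c η ρ (biasContrast D b n m) := by
  have := hD.isProbabilityMeasure
  have := isProbabilityMeasure_latentLaw m D
  have hc1 := hD.le_one hc
  have hη2 : η < 1 / 2 := by linarith
  have hm0 : (0 : ℝ) < m := by
    rcases Nat.eq_zero_or_pos m with rfl | h
    · simp at hp
      linarith
    · exact_mod_cast h
  have hρ4 : ρ ≤ 1 / 4 := by
    have h1 : ∑ _σ : Bool × Bool, ρ * m ≤ m := by
      calc ∑ _σ : Bool × Bool, ρ * (m : ℝ) ≤ ∑ σ, ((intersectionSet G₁ G₂ σ).card : ℝ) :=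
            Finset.sum_le_sum fun σ _ => hI σ
        _ = m := by exact_mod_cast sum_card_intersectionSet G₁ G₂
    simp at h1
    nlinarith
  have hnm : n ≤ m := by
    have : (n : ℝ) ≤ m := (div_le_one hm0).1 (by linarith)
    exact_mod_cast this
  have hn : (n : ℝ) = m * ((n : ℝ) / m) := by field_simp
  obtain ⟨s, hs⟩ := exists_signedContrast_eq_abs D b n m
  set B := biasContrast D b n m
  set p : ℝ := (n : ℝ) / m with hpdef
  set q := quantile D (1 - p) with hqdef
  set t := |B|
  have ht : 0 < t := abs_pos.2 hB
  have hq : q ∈ D.support := hD.quantile_mem_support hc (by linarith) (by linarith)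
  have hqI := hD.support_subset hq
  have htc : c * t ≤ 2 := by
    have h1 : ∀ σ, 0 ≤ b σ q ∧ b σ q ≤ 1 / c := fun σ =>
      ⟨(hb σ).nonneg q hqI.1, (hb σ).le_bound q hq⟩
    have h2 : t ≤ 2 / c := by
      rw [hs, signedContrast]
      have h3 : 2 / c = 1 / c + 1 / c := by ring
      linarith [(h1 (false, !s)).2, (h1 (true, s)).2, (h1 (true, !s)).1, (h1 (false, s)).1]
    rwa [le_div_iff₀ hc, mul_comm] at h2
  have hgap : gap c η ρ B = (c ^ 4 * ρ * η * t) ^ 2 := by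
    rw [gap, min_eq_left (by linarith), mul_pow, mul_pow _ t, sq_abs]
  rw [hgap]
  set φ := (c ^ 4 * ρ * η * t) ^ 2 with hφdef
  have hφ : 0 ≤ φ := sq_nonneg _
  set τ := tolerance c η ρ t with hτdef
  have hτ : 0 < τ := by rw [hτdef, tolerance]; positivity
  set ℓ := min (c * (c * t / 4) ^ 2 / 2) (c * η ^ 2 / 2) with hℓdef
  have hℓ : 0 ≤ ℓ := le_min (by positivity) (by positivity)
  -- The sums that have to be close to their expectations.
  let g : Bool × Bool → ℝ → ℝ := shortfall (positivePart s) q (c * t / 4)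
  let dg : Bool × Bool → (Fin m → ℝ) → ℝ := fun σ => deviation D (intersectionSet G₁ G₂ σ) (g σ)
  let dc : (Fin m → ℝ) → ℝ := deviation D Finset.univ ((Ioi q).indicator fun _ => 1 / c)
  let du : (Fin m → ℝ) → ℝ := deviation D Finset.univ fun x => max (x - q) 0
  have hgℓ : ∀ σ, ℓ ≤ ∫ x, g σ x ∂D := fun σ =>
    hD.min_le_integral_shortfall hc hη hp hp' (by positivity) _ σ
  have hcmean : ∫ x, (Ioi q).indicator (fun _ => 1 / c) x ∂D = p * (1 / c) := by
    rw [integral_indicator measurableSet_Ioi, setIntegral_const, smul_eq_mul, hqdef,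
      hD.real_Ioi_quantile hc (by linarith) (by linarith)]
    ring
  have humean := hD.mul_add_integral_max_le hc (by linarith) (by linarith : p < 1)
  rw [← hqdef] at humean
  have hratio1 : ∀ᵐ w ∂(latentLaw m D), ratio xt xs w ≤ 1 := by
    filter_upwards [hxt, hxs, ae_latentLaw_forall hD.ae_mem_Icc] with w hwt hws hw
    exact (div_utility_mem_Icc (fun i => (hw i).1) hws hwt).2
  have hpoint : ∀ᵐ w ∂(latentLaw m D), ratio xt xs w ≤ 1 - φ * (1 + η ^ 2 / 2)
      + 6 * φ / (m * τ) ^ 2 * (∑ σ, dg σ w ^ 2 + dc w ^ 2 + du w ^ 2) := by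
    filter_upwards [hxt, hxs, hratio1,
      ae_latentLaw_forall (IsLatentDistribution.ae_mem_support (D := D))] with w hwt hws hr1 hw
    have hwI : ∀ i, w i ∈ Icc 0 (1 / c) := fun i => hD.support_subset (hw i)
    obtain ⟨σ, hσ⟩ := exists_utility_le_sub_shortfall hc hd hD hb s ht hs hq hw hwt
    have hstep : ratio xt xs w ≤ 1 - φ * (1 + η ^ 2 / 2)
        + 6 * φ / (m * τ) ^ 2 * (dg σ w ^ 2 + dc w ^ 2 + du w ^ 2) := by
      refine le_one_sub_add_sq hφ hη.le (by linarith) (by positivity) hr1 fun hsmall => ?_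
      refine div_le_of_le_mul₀ (utility_nonneg (fun i => (hwI i).1) _) ?_ ?_
      · exact sub_nonneg.2 (gap_mul_one_add_le_one hc hc1 hη hη2 hρ hρ4 ht.le htc)
      · refine le_one_sub_mul_of_deviation (M := m * (ρ * ℓ))
          (U := m * ((p - c ^ 2 * p ^ 2 / 2) / c)) hφ hη.le
          (gap_mul_one_add_le_one hc hc1 hη hη2 hρ hρ4 ht.le htc) hσ ?_
          (utility_le_mul_add hws.1 w q) ?_ ?_ ?_ (by positivity) ?_ hsmall
        · have h1 := hws.sub_le_utility (q := q) (r := 1 / c) hnm fun i => abs_le.2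
            ⟨by linarith [(hwI i).1, hqI.2], by linarith [(hwI i).2, hqI.1]⟩
          have h2 : dc w = ∑ i, (Ioi q).indicator (fun _ => 1 / c) (w i) - n * (1 / c) := by
            simp only [dc, deviation]
            rw [hcmean, Finset.card_univ, Fintype.card_fin, ← mul_assoc, ← hn]
          rwa [h2]
        · have h1 : m * (ρ * ℓ) ≤ (intersectionSet G₁ G₂ σ).card * ∫ x, g σ x ∂D := by
            calc m * (ρ * ℓ) = ρ * m * ℓ := by ring
              _ ≤ _ := mul_le_mul (hI σ) (hgℓ σ) hℓ (Nat.cast_nonneg _)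
          have h2 := neg_abs_le (dg σ w)
          have h3 : dg σ w = ∑ i ∈ intersectionSet G₁ G₂ σ, g σ (w i)
            - (intersectionSet G₁ G₂ σ).card * ∫ x, g σ x ∂D := rfl
          change m * (ρ * ℓ) - |dg σ w| ≤ ∑ i ∈ intersectionSet G₁ G₂ σ, g σ (w i)
          linarith
        · have h1 : du w = ∑ i, max (w i - q) 0 - m * ∫ x, max (x - q) 0 ∂D := by
            simp only [du, deviation]
            rw [Finset.card_univ, Fintype.card_fin]
          have h2 := le_abs_self (du w)
          have h3 := mul_le_mul_of_nonneg_left humean hm0.le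
          rw [mul_add, ← mul_assoc, ← hn] at h3
          linarith
        · have := mul_le_mul_of_nonneg_left
            (gap_mul_le hc hc1 hη hp hp' hρ hρ4 ht.le htc) hm0.le
          linarith
        · have := mul_le_mul_of_nonneg_left
            (four_mul_tolerance_le hc hη (by linarith) hρ ht.le htc) hm0.le
          linarith
    refine hstep.trans ?_
    gcongr
    exact Finset.single_le_sum (f := fun σ => dg σ w ^ 2) (fun σ _ => sq_nonneg _)
      (Finset.mem_univ σ)
  have hdg := fun σ => integrable_deviation_sq_and_le (D := D) (intersectionSet G₁ G₂ σ)
    (measurable_shortfall (positivePart s) q (c * t / 4) σ)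
    (hD.ae_mem_Icc.mono fun x hx => shortfall_mem_Icc hqI hx)
  have hdc := integrable_deviation_sq_and_le (D := D) (Finset.univ : Finset (Fin m))
    (g := (Ioi q).indicator fun _ => 1 / c) (measurable_const.indicator measurableSet_Ioi)
    (M := 1 / c) (ae_of_all _ fun x => ⟨indicator_nonneg (fun _ _ => by positivity) x,
      indicator_le_self' (fun _ _ => by positivity) x⟩)
  have hdu := integrable_deviation_sq_and_le (D := D) (Finset.univ : Finset (Fin m))
    (g := fun x => max (x - q) 0) (by fun_prop) (M := 1 / c)
    (hD.ae_mem_Icc.mono fun x hx => ⟨le_max_right _ _,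
      max_le (by linarith [hx.2, hqI.1]) (by positivity)⟩)
  have hsumint : Integrable (fun w => ∑ σ, dg σ w ^ 2) (latentLaw m D) :=
    integrable_finsetSum _ fun σ _ => (hdg σ).1
  have hQint : Integrable (fun w => ∑ σ, dg σ w ^ 2 + dc w ^ 2 + du w ^ 2) (latentLaw m D) :=
    (hsumint.add hdc.1).add hdu.1
  have hQ : ∫ w, (∑ σ, dg σ w ^ 2 + dc w ^ 2 + du w ^ 2) ∂(latentLaw m D)
      ≤ 6 * (m * (1 / c / 2) ^ 2) := by
    have h2 : Integrable (fun w => ∑ σ, dg σ w ^ 2 + dc w ^ 2) (latentLaw m D) :=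
      hsumint.add hdc.1
    rw [integral_add h2 hdu.1, integral_add hsumint hdc.1,
      integral_finsetSum _ fun σ _ => (hdg σ).1]
    have h1 : ∑ σ, ∫ w, dg σ w ^ 2 ∂(latentLaw m D) ≤ 4 * (m * (1 / c / 2) ^ 2) :=
      (Finset.sum_le_sum fun σ _ => (hdg σ).2).trans (by simp)
    linarith [hdc.2, hdu.2]
  have herr : 6 * φ / (m * τ) ^ 2 * (6 * (m * (1 / c / 2) ^ 2)) ≤ φ * (η ^ 2 / 2) := by
    have h1 : 18 / (c ^ 2 * τ ^ 2 * η ^ 2) ≤ m := Nat.ceil_le.1 hm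
    have h2 : 6 * φ / (m * τ) ^ 2 * (6 * (m * (1 / c / 2) ^ 2))
        = φ * (η ^ 2 / 2) * (18 / (c ^ 2 * τ ^ 2 * η ^ 2) / m) := by
      field_simp
      ring
    rw [h2]
    exact mul_le_of_le_one_right (by positivity) ((div_le_one hm0).2 h1)
  calc utilityRatio D xt xs
      ≤ ∫ w, (1 - φ * (1 + η ^ 2 / 2)
          + 6 * φ / (m * τ) ^ 2 * (∑ σ, dg σ w ^ 2 + dc w ^ 2 + du w ^ 2)) ∂(latentLaw m D) :=
        integral_mono_ae (integrable_ratio hD hb hxt hxs)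
          ((integrable_const _).add (hQint.const_mul _)) hpoint
    _ = 1 - φ * (1 + η ^ 2 / 2) + 6 * φ / (m * τ) ^ 2
          * ∫ w, (∑ σ, dg σ w ^ 2 + dc w ^ 2 + du w ^ 2) ∂(latentLaw m D) := by
        rw [integral_add (integrable_const _) (hQint.const_mul _), integral_const_mul]
        simp
    _ ≤ 1 - φ * (1 + η ^ 2 / 2) + 6 * φ / (m * τ) ^ 2 * (6 * (m * (1 / c / 2) ^ 2)) := by
        gcongr
    _ ≤ 1 - φ := by linarith

end Selection

end

theorem mainTheorem4 (c η ρ : ℝ) (hc : 0 < c) (hη : 0 < η) (hρ : 0 < ρ) :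
    ∃ m₀ : ℝ → ℕ, AntitoneOn m₀ (Set.Ioi 0) ∧
      ∀ (d : ℝ), 0 < d →
      ∀ (D : Measure ℝ), Selection.IsLatentDistribution c D →
      ∀ (b : Bool × Bool → ℝ → ℝ), (∀ σ, Selection.IsBiasFunction c d D (b σ)) →
      ∀ (m n : ℕ), η < (n : ℝ) / m → (n : ℝ) / m < 1 - η →
      ∀ (G₁ G₂ : Finset (Fin m)),
        (∀ σ, ρ * m ≤ ((Selection.intersectionSet G₁ G₂ σ).card : ℝ)) →
      m₀ |Selection.biasContrast D b n m| ≤ m →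
      ∀ (L₁ L₂ : ℕ) (xt xs : (Fin m → ℝ) → Finset (Fin m)),
        (∀ᵐ w ∂(Selection.latentLaw m D),
          Selection.IsConstrainedOptimal n L₁ L₂ G₁ G₂ (Selection.observed b G₁ G₂ w) (xt w)) →
        (∀ᵐ w ∂(Selection.latentLaw m D), Selection.IsLatentOptimal n w (xs w)) →
        Integrable (Selection.ratio xt xs) (Selection.latentLaw m D) ∧
          Selection.utilityRatio D xt xs ≤
            1 - Selection.gap c η ρ (Selection.biasContrast D b n m) := by
  refine ⟨Selection.threshold c η ρ, Selection.antitoneOn_threshold hc hη hρ, ?_⟩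
  intro d hd D hD b hb m n hp hp' G₁ G₂ hI hm L₁ L₂ xt xs hxt hxs
  have hint := Selection.integrable_ratio hD hb hxt hxs
  refine ⟨hint, ?_⟩
  -- Without contrast the gap is zero, and the ratio is at most one by optimality.
  by_cases hB : Selection.biasContrast D b n m = 0
  · have := hD.isProbabilityMeasure
    have := Selection.isProbabilityMeasure_latentLaw m D
    have h1 : ∀ᵐ w ∂(Selection.latentLaw m D), Selection.ratio xt xs w ≤ 1 := by
      filter_upwards [hxt, hxs, Selection.ae_latentLaw_forall hD.ae_mem_Icc] with w hwt hws hw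
      exact (Selection.div_utility_mem_Icc (fun i => (hw i).1) hws hwt).2
    have h2 := integral_mono_ae hint (integrable_const 1) h1
    simpa [hB, Selection.gap, Selection.utilityRatio] using h2
  · exact Selection.utilityRatio_le hc hη hρ hd hD hb hp hp' hI hB hm hxt hxs
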